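/- **Conventions.** Fix a finite set $\mathbf V$ of endogenous variables, each $V$ with a range $\mathrm{Val}(V)$, and write $\mathrm{Val}(\mathbf S)=\prod_{S\in\mathbf S}\mathrm{Val}(S)$, with coordinate projections $\pi$. An intervention is some $\mathbf x\in\mathrm{Val}(\mathbf X)$ with $\mathbf X\subseteq\mathbf V$; a potential outcome $Y_{\mathbf x}$ is a pair of a variable $Y\in\mathbf V$ and an intervention $\mathbf x$. Probability distributions are given by mass functions. **RCMs.** A Rubin causal model $\mathcal R$ consists of a finite set $\mathcal U$ of units with a probability distribution $P$, a set $\mathfrak O$ of potential outcomes, and for every $Y_{\mathbf x}\in\mathfrak O$ one response function $Y_{\mathbf x}:\mathcal U\to\mathrm{Val}(Y)$. It is effective if $Y_{\mathbf x}(u)=\pi_Y(\mathbf x)$ for all $u$ whenever $Y_{\mathbf x}\in\mathfrak O$ and $Y\in\mathbf X$; all RCMs below are effective. It is full if no RCM on the same units, with the same distribution, defines a strictly larger set of potential outcomes and has the same responses on $\mathfrak O$. Its counterfactual distribution is the pushforward of $P$ to joint values of $\mathfrak O$. We write $y_{\mathbf x}$ for the event that $Y_{\mathbf x}$ is defined and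 takes the value $y$, and $\mathbf P$ for probabilities under the counterfactual distribution. **SCMs.** A structural causal model $\mathcal M$ consists of finitely many exogenous variables $\mathbf U$ with a probability distribution $P$ on $\mathrm{Val}(\mathbf U)$, and for each $V\in\mathbf V$ sets $\mathbf U_V\subseteq\mathbf U$, $\mathbf{Pa}_V\subseteq\mathbf V\setminus\{V\}$ and a function $f_V:\mathrm{Val}(\mathbf U_V\cup\mathbf{Pa}_V)\to\mathrm{Val}(V)$. The intervention $\mathbf x$ replaces $f_V$, for $V\in\mathbf X$, by the constant $\pi_V(\mathbf x)$. If for all $\mathbf u,\mathbf x$ the resulting equations have a unique solution $\mathbf v$, set $Y_{\mathbf x}(\mathbf u)=\pi_Y(\mathbf v)$; the pushforward of $P$ is the counterfactual distribution of $\mathcal M$, on all potential outcomes. $\mathcal M$ represents $\mathcal R$ if it has unique solutions and its counterfactual distribution marginalizes to that of $\mathcal R$ on $\mathfrak O$. For a DAG $\mathcal D$ over $\mathbf V$, $\mathcal M\in\mathfrak M(\mathcal D)$ means that $V\to V'$ in $\mathcal D$ iff $V\in\mathbf{Pa}_{V'}$, and that there is no confounding: the sets $(\mathbf U_V)_{V\in\mathbf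 V}$ are pairwise disjoint and mutually independent under $P$. **SWIGs.** Let $\mathbf{Pa}^{\mathcal D}_V$ and $\mathbf{An}^{\mathcal D}_V\ni V$ be the parents and ancestors of $V$ in $\mathcal D$. For an intervention $\mathbf x$, the single-world intervention graph $\mathcal D_{\mathbf x}$ has a random node for each $V\in\mathbf V$, labelled by the potential outcome $V_{\pi_{\mathbf A}(\mathbf x)}$ with $\mathbf A=(\mathbf{An}^{\mathcal D}_V\cap\mathbf X)\setminus\{V\}$, and a fixed node for each $V\in\mathbf X$. For each edge $V\to V'$ of $\mathcal D$ it has an edge to the random node of $V'$, from the fixed node of $V$ if $V\in\mathbf X$ and from the random node of $V$ otherwise. Sets $A,B$ of nodes of a directed graph are d-separated given $C$ if every path (ignoring arrow directions, without repeated nodes, one-node paths included) from a node of $A$ to a node of $B$ contains a collider (a node $M$ with $\to M\leftarrow$ on the path) none of whose descendants, itself included, is in $C$, or a non-collider (possibly an endpoint) that is in $C$. Fixed nodes are treated like any other node. **Proposition.** Let $\mathcal D$ be a DAG over $\mathbf V$ and suppose that the SCM $\mathcal M\in\mathfrak M(\mathcal D)$ represents the full (effective) RCM $\mathcal R$. Then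 $\mathcal R$ is an FFRCISTG over $\mathcal D$, that is, $\mathcal R$ is a full RCM and its counterfactual distribution satisfies 1. (exclusion restriction) $\mathbf P\big[\neg(y_{\mathbf a}\leftrightarrow y_{\mathbf p})\big]=0$ for every $Y\in\mathbf V$, every $\mathbf A$ with $\mathbf{Pa}^{\mathcal D}_Y\subseteq\mathbf A\subseteq\mathbf V\setminus\{Y\}$, every $\mathbf a\in\mathrm{Val}(\mathbf A)$ and $y\in\mathrm{Val}(Y)$, where $\mathbf p=\pi_{\mathbf{Pa}^{\mathcal D}_Y}(\mathbf a)$; 2. (SWIG separation) for every intervention $\mathbf x$ and all sets $\{(X_i)_{\mathbf p_i}\}_{i}$, $\{(Y_j)_{\mathbf p'_j}\}_{j}$, $\{(Z_k)_{\mathbf p''_k}\}_{k}$ of random nodes of $\mathcal D_{\mathbf x}$ (identified with their labels) such that the first two are d-separated given the third in $\mathcal D_{\mathbf x}$, and for all values $x_i,y_j,z_k$ of these, $$\mathbf P\Big[\bigwedge_{i,j,k}(x_i)_{\mathbf p_i}\wedge(y_j)_{\mathbf p'_j}\wedge(z_k)_{\mathbf p''_k}\Big]\cdot\mathbf P\Big[\bigwedge_k(z_k)_{\mathbf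 p''_k}\Big]=\mathbf P\Big[\bigwedge_{i,k}(x_i)_{\mathbf p_i}\wedge(z_k)_{\mathbf p''_k}\Big]\cdot\mathbf P\Big[\bigwedge_{j,k}(y_j)_{\mathbf p'_j}\wedge(z_k)_{\mathbf p''_k}\Big].$$ -/

import Mathlib

/-! ### Interventions and potential outcomes -/

/-- An intervention `x ∈ Val(X)` for some `X ⊆ V`, as a partial valuation of the endogenous
variables: `x v = some a` when `v ∈ X` and `π_v(x) = a`, and `x v = none` when `v ∉ X`. -/
abbrev Intervention {V : Type*} (Val : V → Type*) : Type _ := (v : V) → Option (Val v)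

namespace Intervention

variable {V : Type*} {Val : V → Type*}

/-- The set `X` of variables that are intervened on. -/
def dom (x : Intervention Val) : Set V := {v | x v ≠ none}

open Classical in
/-- The projection `π_{A ∩ X}(x)`. -/
noncomputable def proj (x : Intervention Val) (A : Set V) : Intervention Val :=
  fun v => if v ∈ A then x v else none

end Intervention

/-- A potential outcome `Y_x`. -/
structure PotentialOutcome {V : Type*} (Val : V → Type*) where
  /-- the outcome variable `Y` -/
  var : V
  /-- the intervention `x` -/
  intv : Intervention Val

/-- `Val(O)`: joint valuations of a set `O` of potential outcomes. -/
abbrev Counterfactual {V : Type*} {Val : V → Type*} (O : Set (PotentialOutcome Val)) : Type _ :=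
  (o : O) → Val o.1.var

/-! ### Rubin causal models -/

/-- A Rubin causal model with units `𝒰` over the variables `V`: a set of potential outcomes, one
potential response for each of them, and a probability distribution on units. -/
structure RCM (𝒰 : Type*) {V : Type*} (Val : V → Type*) where
  outcomes : Set (PotentialOutcome Val)
  response : (o : outcomes) → 𝒰 → Val o.1.var
  P : PMF 𝒰

namespace RCM

variable {𝒰 : Type*} {V : Type*} {Val : V → Type*}

/-- Effectiveness: `Y_x(u) = π_Y(x)` for every unit `u` and every defined potential outcome `Y_x`
with `Y ∈ X`. -/
def Effective (R : RCM 𝒰 Val) : Prop :=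
  ∀ (o : R.outcomes) (y : Val o.1.var), o.1.intv o.1.var = some y → ∀ i : 𝒰, R.response o i = y

/-- The counterfactual distribution: pushforward of the distribution on units. -/
noncomputable def Pcf (R : RCM 𝒰 Val) : PMF (Counterfactual R.outcomes) :=
  R.P.map (fun i o => R.response o i)

/-- `R'` extends `R`: same units (with the same distribution), more potential outcomes, and the
same responses on the common ones. -/
def Extends (R' R : RCM 𝒰 Val) : Prop :=
  R'.P = R.P ∧ ∃ h : R.outcomes ⊆ R'.outcomes,
    ∀ o : R.outcomes, R'.response ⟨o.1, h o.2⟩ = R.response o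

/-- `R` is full: it has no proper extension among effective RCMs. -/
def Full (R : RCM 𝒰 Val) : Prop :=
  ∀ R' : RCM 𝒰 Val, R'.Effective → R'.Extends R → R'.outcomes = R.outcomes

/-- The probability of an event under the counterfactual distribution. -/
noncomputable def prob (R : RCM 𝒰 Val) (E : Set (Counterfactual R.outcomes)) : ENNReal :=
  R.Pcf.toOuterMeasure E

end RCM

/-- The atom `Y_x = y` holds in the counterfactual `ω`: the potential outcome `Y_x` is defined and
takes the value `y`. -/
def Counterfactual.Holds {V : Type*} {Val : V → Type*} {O : Set (PotentialOutcome Val)}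
    (ω : Counterfactual O) (o : PotentialOutcome Val) (y : Val o.var) : Prop :=
  ∃ h : o ∈ O, ω ⟨o, h⟩ = y

/-! ### Structural causal models -/

/-- A structural causal model with exogenous variables `U` (ranges `UVal`) and endogenous variables
`V` (ranges `Val`). -/
structure SCM {U V : Type*} (UVal : U → Type*) (Val : V → Type*) where
  /-- the exogenous variables `U_v` on which `v` depends -/
  exo : V → Set U
  /-- the endogenous variables `Pa_v` on which `v` depends -/
  pa : V → Set V
  notMem_pa : ∀ v, v ∉ pa v
  /-- the structural functions -/
  f : (v : V) → ((u : exo v) → UVal u.1) → ((w : pa v) → Val w.1) → Val v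
  P : PMF ((u : U) → UVal u)

namespace SCM

variable {U V : Type*} {UVal : U → Type*} {Val : V → Type*}

/-- The manipulated model `M_x`: for `v ∈ X` both `U_v` and `Pa_v` become empty and the structural
function becomes the constant `π_v(x)`; everything else is unchanged. -/
def manipulate (M : SCM UVal Val) (x : Intervention Val) : SCM UVal Val where
  exo v := {u | u ∈ M.exo v ∧ x v = none}
  pa v := {w | w ∈ M.pa v ∧ x v = none}
  notMem_pa v h := M.notMem_pa v h.1
  f v e p :=
    match hx : x v with
    | some a => a
    | none => M.f v (fun u => e ⟨u.1, u.2, hx⟩) (fun w => p ⟨w.1, w.2, hx⟩)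
  P := M.P

/-- `M, u ⊨ v`: the joint valuation `val` solves all structural equations at `u`. -/
def Solves (M : SCM UVal Val) (u : (i : U) → UVal i) (val : (v : V) → Val v) : Prop :=
  ∀ v, M.f v (fun i => u i.1) (fun w => val w.1) = val v

/-- The class of SCMs having, for every `u` and every intervention, exactly one solution. -/
def Uniq (M : SCM UVal Val) : Prop :=
  ∀ (u : (i : U) → UVal i) (x : Intervention Val),
    ∃! val : (v : V) → Val v, (M.manipulate x).Solves u val

/-- The potential outcome `Y_x(u)` of an SCM with unique solutions. -/
noncomputable def potentialOutcome (M : SCM UVal Val) (hM : M.Uniq) (u : (i : U) → UVal i)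
    (o : PotentialOutcome Val) : Val o.var :=
  (hM u o.intv).choose o.var

/-- The counterfactual distribution of an SCM, over all potential outcomes. -/
noncomputable def Pcf (M : SCM UVal Val) (hM : M.Uniq) :
    PMF ((o : PotentialOutcome Val) → Val o.var) :=
  M.P.map (fun u o => M.potentialOutcome hM u o)

/-- `M` represents `R`: `M` has unique solutions, `R` is effective, and the counterfactual
distribution of `M` marginalizes down to that of `R` on the potential outcomes defined by `R`. -/
def Represents {𝒰 : Type*} (M : SCM UVal Val) (R : RCM 𝒰 Val) : Prop :=
  R.Effective ∧ ∃ hM : M.Uniq, (M.Pcf hM).map (fun ω (o : R.outcomes) => ω o.1) = R.Pcf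

/-- Mutual independence under `P` of the family of exogenous blocks `(U_v)_{v ∈ V}`
(for the discrete distribution `P`, stated through probabilities of joint values). -/
def IndependentExo [Fintype V] (M : SCM UVal Val) : Prop :=
  ∀ e : (v : V) → (u : M.exo v) → UVal u.1,
    M.P.toOuterMeasure {u | ∀ v, (fun i : M.exo v => u i.1) = e v}
      = ∏ v, M.P.toOuterMeasure {u | (fun i : M.exo v => u i.1) = e v}

/-- `M` has causal diagram `D`, a directed graph without bidirected arcs: the directed edges are
given by the parent sets, and distinct variables are unconfounded, that is, the exogenous blocks
`U_v` do not overlap and are independent. -/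
def HasDiagram [Fintype V] (M : SCM UVal Val) (D : Digraph V) : Prop :=
  (∀ v w, D.Adj v w ↔ v ∈ M.pa w) ∧
  (∀ v w, v ≠ w → Disjoint (M.exo v) (M.exo w)) ∧
  M.IndependentExo

end SCM

/-! ### Directed graphs and d-separation -/

namespace Digraph

variable {N : Type*}

/-- There are no directed cycles. -/
def Acyclic (G : Digraph N) : Prop := ∀ v, ¬ Relation.TransGen G.Adj v v

/-- Directed parents. -/
def parents (G : Digraph N) (v : N) : Set N := {w | G.Adj w v}

/-- Directed ancestors, including `v` itself. -/
def ancestors (G : Digraph N) (v : N) : Set N := {w | Relation.ReflTransGen G.Adj w v}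

/-- Directed descendants, including `v` itself. -/
def descendants (G : Digraph N) (v : N) : Set N := {w | Relation.ReflTransGen G.Adj v w}

/-- `m` is a collider on the path with list of vertices `p`: the path has the form
`… a → m ← b …`. -/
def IsCollider (G : Digraph N) (p : List N) (m : N) : Prop :=
  ∃ a b, [a, m, b] <:+: p ∧ G.Adj a m ∧ G.Adj b m

/-- The path with list of vertices `p` is blocked by `Z`: it has a collider without descendants in
`Z`, or a non-collider (possibly an endpoint) in `Z`. -/
def Blocked (G : Digraph N) (p : List N) (Z : Set N) : Prop :=
  ∃ m ∈ p, (G.IsCollider p m ∧ Disjoint (G.descendants m) Z) ∨ (¬ G.IsCollider p m ∧ m ∈ Z)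

/-- `X` and `Y` are d-separated given `Z`: every path, disregarding the direction of the arrows,
from a node of `X` to a node of `Y` is blocked by `Z`. The one-vertex path from a node to itself
is included. -/
def DSep (G : Digraph N) (X Y Z : Set N) : Prop :=
  ∀ a ∈ X, ∀ b ∈ Y, ∀ p : (SimpleGraph.fromRel G.Adj).Walk a b, p.IsPath → G.Blocked p.support Z

end Digraph

/-! ### Single-world intervention graphs -/

section SWIG

variable {V : Type*} {Val : V → Type*}

/-- The SWIG `D_x`. The node `Sum.inl v` is the random node of `v ∈ V`, and `Sum.inr v` is the fixed
node of `v ∈ X`. Edges `v → w` of `D` start at the fixed node of `v` when `v ∈ X` and at its random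
node otherwise; they always end at the random node of `w`. -/
def swig (D : Digraph V) (x : Intervention Val) : Digraph (V ⊕ x.dom) where
  Adj
    | Sum.inl v, Sum.inl w => v ∉ x.dom ∧ D.Adj v w
    | Sum.inr v, Sum.inl w => D.Adj v.1 w
    | _, Sum.inr _ => False

/-- The label `V_{π_A(x)}` of the random node of `v`, where `A = (An_v ∩ X) \ {v}`. -/
noncomputable def swigLabel (D : Digraph V) (x : Intervention Val) (v : V) :
    PotentialOutcome Val where
  var := v
  intv := x.proj ((D.ancestors v ∩ x.dom) \ {v})

/-- The event that each random node `v ∈ S` of `D_x` takes the value `s v`. -/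
def swigEvent (O : Set (PotentialOutcome Val)) (D : Digraph V) (x : Intervention Val)
    {S : Set V} (s : (v : S) → Val v.1) : Set (Counterfactual O) :=
  {ω | ∀ v : S, ω.Holds (swigLabel D x v.1) (s v)}

end SWIG

namespace RCM

variable {𝒰 V : Type*} {Val : V → Type*}

/-- `R` satisfies every instance of `T(ER^D)`, that is `P[¬(y_a ↔ y_p)] = 0`, for every variable
`Y`, every intervention `a` on a set `A` with `Pa_Y ⊆ A ⊆ V \ {Y}`, and `p = π_{Pa_Y}(a)`. -/
def ExclusionRestriction (R : RCM 𝒰 Val) (D : Digraph V) : Prop :=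
  ∀ (Y : V) (a : Intervention Val), D.parents Y ⊆ a.dom → Y ∉ a.dom → ∀ y : Val Y,
    R.prob {ω | ¬ (ω.Holds ⟨Y, a⟩ y ↔ ω.Holds ⟨Y, a.proj (D.parents Y)⟩ y)} = 0

/-- `R` satisfies every instance of `sw-sep^{D_x}`, for every intervention `x`. -/
def SwSep (R : RCM 𝒰 Val) (D : Digraph V) : Prop :=
  ∀ (x : Intervention Val) (X Y Z : Set V),
    (swig D x).DSep (Sum.inl '' X) (Sum.inl '' Y) (Sum.inl '' Z) →
    ∀ (a : (v : X) → Val v.1) (b : (v : Y) → Val v.1) (c : (v : Z) → Val v.1),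
      R.prob (swigEvent R.outcomes D x a ∩ swigEvent R.outcomes D x b
          ∩ swigEvent R.outcomes D x c) * R.prob (swigEvent R.outcomes D x c)
        = R.prob (swigEvent R.outcomes D x a ∩ swigEvent R.outcomes D x c)
          * R.prob (swigEvent R.outcomes D x b ∩ swigEvent R.outcomes D x c)

/-- The (effective) RCM `R` is an FFRCISTG over `D`. -/
def IsFFRCISTG (R : RCM 𝒰 Val) (D : Digraph V) : Prop :=
  R.Effective ∧ R.Full ∧ R.ExclusionRestriction D ∧ R.SwSep D

end RCM

/-! Fullness and effectiveness force `R` to define every potential outcome, so its probabilities are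
probabilities of noise events of `M`. The exclusion restriction then holds pointwise: with all
parents of Y fixed, the equation of Y sees nothing else of the intervention.

For SWIG separation, the random node of v carries the `natural` value of v under x: what the
structural function of v returns, even if v is itself intervened on. Conditioning on Z = c is traded
for an intervention. On that event, x and its extension x' by c have the same solution, and the
event may be tested under either (`natural_extend_iff`). Under x', a natural value depends only on
the noise blocks of v and of the ancestors reached through variables that x' leaves free
(`natural_eq_of_agree`).

It remains to split the independent noise blocks into two groups, one determining Y and part of Z,
the other X and the rest of Z. Regard the noise of v as an extra parent of v: the first group H₂
consists of those v for which an active trail entering v from its noise continues to Y. D-separation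
keeps the part of X outside Z off this group (`DSep.not_reaches`). All four probabilities then
factor over the two groups, and both sides are the same product.

The trails defining H₂ may repeat vertices, and their colliders lie in Z itself. `exists_nodup`
turns them into genuine paths, whose colliders only need a descendant in Z. -/

/-! ### Active trails -/

namespace Digraph

variable {N : Type*} {G : Digraph N} {Z : Set N}

/-- `m` is an ancestor of some node of `Z`. -/
def HasDescendantIn (G : Digraph N) (Z : Set N) (m : N) : Prop :=
  ∃ z ∈ Z, Relation.ReflTransGen G.Adj m z

lemma HasDescendantIn.of_adj {a c : N} (h : G.HasDescendantIn Z c) (hac : G.Adj a c) :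
    G.HasDescendantIn Z a := by
  obtain ⟨z, hz, hcz⟩ := h
  exact ⟨z, hz, hcz.head hac⟩

/-- `G.ActiveTrail Z s p`: the vertex list `p` is a trail of `G` that is not blocked by `Z`, where
the Boolean `s` tells whether the first vertex is entered through an arrow pointing to it. -/
inductive ActiveTrail (G : Digraph N) (Z : Set N) : Bool → List N → Prop
  | single (s : Bool) {a : N} : a ∉ Z → ActiveTrail G Z s [a]
  | down (s : Bool) {a c : N} {r : List N} : a ∉ Z → G.Adj a c → ActiveTrail G Z true (c :: r) →
      ActiveTrail G Z s (a :: c :: r)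
  | up {a c : N} {r : List N} : a ∉ Z → G.Adj c a → ActiveTrail G Z false (c :: r) →
      ActiveTrail G Z false (a :: c :: r)
  | collide {a c : N} {r : List N} : G.HasDescendantIn Z a → G.Adj c a →
      ActiveTrail G Z false (c :: r) → ActiveTrail G Z true (a :: c :: r)

namespace ActiveTrail

lemma to_false {s : Bool} {a : N} {r : List N} (h : G.ActiveTrail Z s (a :: r)) (ha : a ∉ Z) :
    G.ActiveTrail Z false (a :: r) := by
  cases h with
  | single _ h => exact .single _ h
  | down _ h h1 h2 => exact .down _ h h1 h2
  | up h h1 h2 => exact .up h h1 h2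
  | collide h h1 h2 => exact .up ha h1 h2

lemma to_true {s : Bool} {a : N} {r : List N} (h : G.ActiveTrail Z s (a :: r))
    (ha : G.HasDescendantIn Z a) : G.ActiveTrail Z true (a :: r) := by
  cases h with
  | single _ h => exact .single _ h
  | down _ h h1 h2 => exact .down _ h h1 h2
  | up h h1 h2 => exact .collide ha h1 h2
  | collide h h1 h2 => exact .collide ha h1 h2

lemma tail {s : Bool} {a c : N} {r : List N} (h : G.ActiveTrail Z s (a :: c :: r)) :
    ∃ t, G.ActiveTrail Z t (c :: r) := by
  cases h with
  | down _ h h1 h2 => exact ⟨_, h2⟩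
  | up h h1 h2 => exact ⟨_, h2⟩
  | collide h h1 h2 => exact ⟨_, h2⟩

lemma suffix {a : N} {r : List N} : ∀ (l : List N) {s : Bool},
    G.ActiveTrail Z s (l ++ a :: r) → ∃ t, G.ActiveTrail Z t (a :: r)
  | [], s, h => ⟨s, h⟩
  | [_], _, h => h.tail
  | _ :: c :: l, _, h => by
      obtain ⟨t, ht⟩ := tail h
      exact suffix (c :: l) ht

/-- Either all steps before `a` point forward, so that `a` is again entered by an arrow, or the
first backward step occurs at a collider, which descends from the initial vertex and has a
descendant in `Z`. -/
lemma suffix_true {a : N} {r : List N} : ∀ (l : List N),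
    G.ActiveTrail Z true (l ++ a :: r) →
      G.ActiveTrail Z true (a :: r) ∨ ∀ c ∈ (l ++ a :: r).head?, G.HasDescendantIn Z c
  | [], h => .inl h
  | b :: l, h => by
      obtain ⟨c, q, hq⟩ : ∃ c q, l ++ a :: r = c :: q := by cases l <;> simp
      have ih := suffix_true (a := a) (r := r) l
      rw [List.cons_append, hq] at h
      rw [hq] at ih
      cases h with
      | down _ h h1 h2 =>
        refine (ih h2).imp_right fun hc => ?_
        simpa using (hc c (by simp)).of_adj h1
      | collide h h1 h2 => exact .inr (by simpa using h)

/-- An active trail can be shortened to one without repeated vertices. -/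
lemma exists_nodup {s : Bool} {p : List N} (h : G.ActiveTrail Z s p) :
    ∃ q, G.ActiveTrail Z s q ∧ q.Nodup ∧ q.head? = p.head? ∧ q.getLast? = p.getLast? := by
  have cut : ∀ {l r q b : List N} {a c : N}, c :: q = l ++ a :: r →
      (c :: q).getLast? = (c :: b).getLast? → (a :: r).getLast? = (a :: c :: b).getLast? := by
    intro l r q b a c h1 h2
    rw [h1, List.getLast?_append_of_ne_nil _ (List.cons_ne_nil _ _)] at h2
    rw [h2, List.getLast?_cons_cons]
  induction h with
  | single s h => exact ⟨_, .single s h, by simp, rfl, rfl⟩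
  | @down s a c r ha hac _ ih =>
    obtain ⟨q, hq, hnd, hhd, hlast⟩ := ih
    obtain ⟨q, rfl⟩ : ∃ q', q = c :: q' := by cases q <;> simp_all
    by_cases hmem : a ∈ c :: q
    · obtain ⟨l, r', hl⟩ := List.append_of_mem hmem
      have hlast' := cut hl hlast
      rw [hl] at hq hnd
      refine ⟨a :: r', ?_, hnd.of_append_right, rfl, hlast'⟩
      obtain ⟨t, ht⟩ := hq.suffix
      -- Cutting out the loop at `a` can turn `a` into a collider when it is entered by an arrow. It
      -- then needs a descendant in `Z`, unless the later occurrence was already entered by an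
      -- arrow.
      cases s with
      | false => exact ht.to_false ha
      | true =>
        rcases hq.suffix_true with h | h
        · exact h
        · exact ht.to_true ((h c (by rw [← hl]; simp)).of_adj hac)
    · refine ⟨a :: c :: q, .down s ha hac hq, hnd.cons hmem, rfl, ?_⟩
      simpa using hlast
  | @up a c r ha hac _ ih =>
    obtain ⟨q, hq, hnd, hhd, hlast⟩ := ih
    obtain ⟨q, rfl⟩ : ∃ q', q = c :: q' := by cases q <;> simp_all
    by_cases hmem : a ∈ c :: q
    · obtain ⟨l, r', hl⟩ := List.append_of_mem hmem
      have hlast' := cut hl hlast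
      rw [hl] at hq hnd
      obtain ⟨t, ht⟩ := hq.suffix
      exact ⟨a :: r', ht.to_false ha, hnd.of_append_right, rfl, hlast'⟩
    · refine ⟨a :: c :: q, .up ha hac hq, hnd.cons hmem, rfl, ?_⟩
      simpa using hlast
  | @collide a c r ha hac _ ih =>
    obtain ⟨q, hq, hnd, hhd, hlast⟩ := ih
    obtain ⟨q, rfl⟩ : ∃ q', q = c :: q' := by cases q <;> simp_all
    by_cases hmem : a ∈ c :: q
    · obtain ⟨l, r', hl⟩ := List.append_of_mem hmem
      have hlast' := cut hl hlast
      rw [hl] at hq hnd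
      obtain ⟨t, ht⟩ := hq.suffix
      exact ⟨a :: r', ht.to_true ha, hnd.of_append_right, rfl, hlast'⟩
    · refine ⟨a :: c :: q, .collide ha hac hq, hnd.cons hmem, rfl, ?_⟩
      simpa using hlast

/-- Colliders are read off the bare vertex list; asymmetry ensures that the trail traversed both
edges in the direction seen there. -/
lemma hasDescendantIn_of_collider (hG : ∀ a b, G.Adj a b → ¬ G.Adj b a) {a m b : N}
    (ham : G.Adj a m) (hbm : G.Adj b m) {r : List N} : ∀ (l : List N) {s : Bool},
    G.ActiveTrail Z s (l ++ a :: m :: b :: r) → G.HasDescendantIn Z m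
  | [], _, h => by
      cases h with
      | down _ _ _ h =>
        cases h with
        | down _ _ h => exact absurd h (hG _ _ hbm)
        | collide h => exact h
      | up _ h => exact absurd h (hG _ _ ham)
      | collide _ h => exact absurd h (hG _ _ ham)
  | [_], _, h => by
      obtain ⟨t, ht⟩ := tail h
      exact hasDescendantIn_of_collider hG ham hbm [] ht
  | _ :: c :: l, _, h => by
      obtain ⟨t, ht⟩ := tail h
      exact hasDescendantIn_of_collider hG ham hbm (c :: l) ht

lemma _root_.Digraph.IsCollider.cons {p : List N} {m : N} (h : G.IsCollider p m) (c : N) :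
    G.IsCollider (c :: p) m := by
  obtain ⟨a, b, h, h'⟩ := h
  exact ⟨a, b, h.trans (List.suffix_cons c p).isInfix, h'⟩

/-- Only `collide` admits a vertex of `Z`. At the head of the list its incoming arrow is not yet
visible, hence the second alternative; prepending the previous vertex turns it into the first. -/
lemma isCollider_of_mem {s : Bool} {p : List N} (h : G.ActiveTrail Z s p) {m : N} (hm : m ∈ p)
    (hmZ : m ∈ Z) :
    G.IsCollider p m ∨ s = true ∧ ∃ d r, p = m :: d :: r ∧ G.Adj d m := by
  induction h with
  | single _ h => simp_all
  | @down s a c r ha hac _ ih =>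
    obtain rfl | hm := List.mem_cons.1 hm
    · exact absurd hmZ ha
    · rcases ih hm with h | ⟨-, d, r', hr, hd⟩
      · exact .inl (h.cons a)
      · obtain ⟨rfl, rfl⟩ := List.cons.inj hr
        exact .inl ⟨a, d, ⟨[], r', by simp⟩, hac, hd⟩
  | @up a c r ha hac _ ih =>
    obtain rfl | hm := List.mem_cons.1 hm
    · exact absurd hmZ ha
    · rcases ih hm with h | ⟨h, -⟩
      · exact .inl (h.cons a)
      · exact absurd h (by simp)
  | @collide a c r ha hac _ ih =>
    obtain rfl | hm := List.mem_cons.1 hm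
    · exact .inr ⟨rfl, c, r, rfl, hac⟩
    · rcases ih hm with h | ⟨h, -⟩
      · exact .inl (h.cons a)
      · exact absurd h (by simp)

lemma not_blocked (hG : ∀ a b, G.Adj a b → ¬ G.Adj b a) {p : List N}
    (h : G.ActiveTrail Z false p) : ¬ G.Blocked p Z := by
  rintro ⟨m, hm, ⟨⟨a, b, ⟨l, r, rfl⟩, ham, hbm⟩, hdisj⟩ | ⟨hcol, hmZ⟩⟩
  · obtain ⟨z, hz, hmz⟩ := hasDescendantIn_of_collider (r := r) hG ham hbm l (by simpa using h)
    exact Set.disjoint_left.1 hdisj hmz hz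
  · rcases h.isCollider_of_mem hm hmZ with h | ⟨h, -⟩
    · exact hcol h
    · exact absurd h (by simp)

lemma exists_walk (hG : ∀ a b, G.Adj a b → ¬ G.Adj b a) {s : Bool} {p : List N}
    (h : G.ActiveTrail Z s p) {a b : N} (ha : p.head? = some a) (hb : p.getLast? = some b) :
    ∃ w : (SimpleGraph.fromRel G.Adj).Walk a b, w.support = p := by
  have hne : ∀ a b, G.Adj a b → a ≠ b := by
    rintro a _ h rfl
    exact hG _ _ h h
  induction h generalizing a with
  | single s h =>
    obtain rfl : _ = a := by simpa using ha
    obtain rfl : _ = b := by simpa using hb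
    exact ⟨.nil, rfl⟩
  | @down s a' c r _ hac _ ih =>
    obtain rfl : a' = a := by simpa using ha
    obtain ⟨w, hw⟩ := ih (a := c) rfl (by simpa using hb)
    exact ⟨.cons (SimpleGraph.fromRel_adj _ _ _ |>.2 ⟨hne _ _ hac, .inl hac⟩) w, by simp [hw]⟩
  | @up a' c r _ hac _ ih =>
    obtain rfl : a' = a := by simpa using ha
    obtain ⟨w, hw⟩ := ih (a := c) rfl (by simpa using hb)
    exact ⟨.cons (SimpleGraph.fromRel_adj _ _ _ |>.2 ⟨(hne _ _ hac).symm, .inr hac⟩) w,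
      by simp [hw]⟩
  | @collide a' c r _ hac _ ih =>
    obtain rfl : a' = a := by simpa using ha
    obtain ⟨w, hw⟩ := ih (a := c) rfl (by simpa using hb)
    exact ⟨.cons (SimpleGraph.fromRel_adj _ _ _ |>.2 ⟨(hne _ _ hac).symm, .inr hac⟩) w,
      by simp [hw]⟩

end ActiveTrail

/-! ### Trails with repetitions, and their exclusion by d-separation -/

/-- `G.Reaches Z Y s v`: some trail from `v` to `Y`, with all colliders in `Z` and all other
vertices outside `Z`, exists, where `s` tells whether `v` is entered through an arrow pointing to
it. -/
inductive Reaches (G : Digraph N) (Z Y : Set N) : Bool → N → Prop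
  | target (s : Bool) {v : N} : v ∉ Z → v ∈ Y → Reaches G Z Y s v
  | down (s : Bool) {v w : N} : v ∉ Z → G.Adj v w → Reaches G Z Y true w → Reaches G Z Y s v
  | up {v w : N} : v ∉ Z → G.Adj w v → Reaches G Z Y false w → Reaches G Z Y false v
  | collide {v w : N} : v ∈ Z → G.Adj w v → Reaches G Z Y false w → Reaches G Z Y true v

namespace Reaches

variable {Y : Set N}

lemma exists_activeTrail {s : Bool} {v : N} (h : G.Reaches Z Y s v) :
    ∃ r, G.ActiveTrail Z s (v :: r) ∧ ∃ y ∈ Y, (v :: r).getLast? = some y := by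
  induction h with
  | @target s v h hv => exact ⟨[], .single s h, v, hv, rfl⟩
  | @down s v w h hvw _ ih =>
    obtain ⟨r, hr, y, hy, hl⟩ := ih
    exact ⟨w :: r, .down s h hvw hr, y, hy, by simpa using hl⟩
  | @up v w h hvw _ ih =>
    obtain ⟨r, hr, y, hy, hl⟩ := ih
    exact ⟨w :: r, .up h hvw hr, y, hy, by simpa using hl⟩
  | @collide v w h hvw _ ih =>
    obtain ⟨r, hr, y, hy, hl⟩ := ih
    exact ⟨w :: r, .collide ⟨v, h, .refl⟩ hvw hr, y, hy, by simpa using hl⟩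

lemma to_false {s : Bool} {v : N} (h : G.Reaches Z Y s v) (hv : v ∉ Z) :
    G.Reaches Z Y false v := by
  cases h with
  | target _ h h' => exact .target _ h h'
  | down _ h h1 h2 => exact .down _ h h1 h2
  | up h h1 h2 => exact .up h h1 h2
  | collide h => exact absurd h hv

end Reaches

lemma DSep.not_reaches (hG : ∀ a b, G.Adj a b → ¬ G.Adj b a) {X Y : Set N} (h : G.DSep X Y Z)
    {v : N} (hv : v ∈ X) : ¬ G.Reaches Z Y false v := by
  intro hr
  obtain ⟨r, hr, y, hy, hl⟩ := hr.exists_activeTrail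
  obtain ⟨q, hq, hnd, hhd, hlast⟩ := hr.exists_nodup
  obtain ⟨w, rfl⟩ := hq.exists_walk hG (a := v) (by rw [hhd]; rfl) (hlast.trans hl)
  exact hq.not_blocked hG (h v hv y hy w ((SimpleGraph.Walk.isPath_def _).2 hnd))

lemma Acyclic.wellFounded [Finite N] (hG : G.Acyclic) : WellFounded G.Adj := by
  have : Std.Irrefl (Relation.TransGen G.Adj) := ⟨hG⟩
  exact Subrelation.wf Relation.TransGen.single
    (Finite.wellFounded_of_trans_of_irrefl (Relation.TransGen G.Adj))

end Digraph

lemma swig_asymm {V : Type*} {Val : V → Type*} {D : Digraph V} (hD : D.Acyclic)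
    (x : Intervention Val) (a b : V ⊕ x.dom) (hab : (swig D x).Adj a b) :
    ¬ (swig D x).Adj b a := by
  intro hba
  rcases a with a | a <;> rcases b with b | b
  · exact hD a (.tail (.single hab.2) hba.2)
  · exact hab
  · exact hba
  · exact hab

/-! ### Independence of blocks -/

namespace PMF

/-- If the variables `b v` are mutually independent, then events determined by disjoint groups of
them are independent. -/
lemma toOuterMeasure_inter_of_determined {V Ω : Type*} [Fintype V] {E : V → Type*} (P : PMF Ω)
    (b : (v : V) → Ω → E v)
    (hind : ∀ e : (v : V) → E v, P.toOuterMeasure {u | ∀ v, b v u = e v}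
      = ∏ v, P.toOuterMeasure {u | b v u = e v})
    (S : Set V) (α β : Set Ω)
    (hα : ∀ u u', (∀ v ∈ S, b v u = b v u') → u ∈ α → u' ∈ α)
    (hβ : ∀ u u', (∀ v ∉ S, b v u = b v u') → u ∈ β → u' ∈ β) :
    P.toOuterMeasure (α ∩ β) = P.toOuterMeasure α * P.toOuterMeasure β := by
  classical
  let Q : PMF ((v : V) → E v) := P.map fun u v => b v u
  let k : (v : V) → E v → ENNReal := fun v y => P.toOuterMeasure {u | b v u = y}
  have hQ : ∀ e, Q e = ∏ v, k v (e v) := by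
    intro e
    rw [← hind, ← toOuterMeasure_apply_singleton Q, toOuterMeasure_map_apply]
    congr 1
    ext u
    simp [funext_iff]
  let φ := Equiv.piEquivPiSubtypeProd (· ∈ S) E
  let q₁ : ((v : {v // v ∈ S}) → E v) → ENNReal := fun e => ∏ v, k v.1 (e v)
  let q₂ : ((v : {v // v ∉ S}) → E v) → ENNReal := fun e => ∏ v, k v.1 (e v)
  -- Since `α` depends only on the blocks in `S`, it is the preimage of its image under them;
  -- likewise `β` outside `S`.
  let α' : Set ((v : {v // v ∈ S}) → E v) := {e | ∃ u ∈ α, ∀ v, b v.1 u = e v}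
  let β' : Set ((v : {v // v ∉ S}) → E v) := {e | ∃ u ∈ β, ∀ v, b v.1 u = e v}
  have hQφ : ∀ e, Q (φ.symm e) = q₁ e.1 * q₂ e.2 := by
    intro e
    rw [hQ, ← Fintype.prod_subtype_mul_prod_subtype (· ∈ S)]
    congr 1
    · refine Finset.prod_congr rfl fun v _ => ?_
      congr 1
      simp [φ, Equiv.piEquivPiSubtypeProd, v.2]
    · refine Finset.prod_congr rfl fun v _ => ?_
      congr 1
      simp [φ, Equiv.piEquivPiSubtypeProd, v.2]
  have key : ∀ (A : Set ((v : {v // v ∈ S}) → E v)) (B : Set ((v : {v // v ∉ S}) → E v)),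
      Q.toOuterMeasure {e | (φ e).1 ∈ A ∧ (φ e).2 ∈ B}
        = (∑' e, A.indicator q₁ e) * ∑' e, B.indicator q₂ e := by
    intro A B
    rw [toOuterMeasure_apply, ← φ.symm.tsum_eq, ENNReal.tsum_prod', ← ENNReal.tsum_mul_right]
    refine tsum_congr fun e₁ => ?_
    rw [← ENNReal.tsum_mul_left]
    refine tsum_congr fun e₂ => ?_
    simp only [Set.indicator_apply, Set.mem_ofPred_eq, Equiv.apply_symm_apply, hQφ]
    by_cases h₁ : e₁ ∈ A <;> by_cases h₂ : e₂ ∈ B <;> simp [h₁, h₂]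
  have hα' : ∀ u, u ∈ α ↔ (φ fun v => b v u).1 ∈ α' := fun u =>
    ⟨fun h => ⟨u, h, fun _ => rfl⟩, fun ⟨u', h, h'⟩ => hα u' u (fun v hv => h' ⟨v, hv⟩) h⟩
  have hβ' : ∀ u, u ∈ β ↔ (φ fun v => b v u).2 ∈ β' := fun u =>
    ⟨fun h => ⟨u, h, fun _ => rfl⟩, fun ⟨u', h, h'⟩ => hβ u' u (fun v hv => h' ⟨v, hv⟩) h⟩
  have e₁ : P.toOuterMeasure (α ∩ β) = Q.toOuterMeasure {e | (φ e).1 ∈ α' ∧ (φ e).2 ∈ β'} := by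
    rw [toOuterMeasure_map_apply]
    congr 1
    ext u
    simp only [Set.mem_inter_iff, hα', hβ', Set.mem_preimage, Set.mem_ofPred_eq]
  have e₂ : P.toOuterMeasure α
      = Q.toOuterMeasure {e | (φ e).1 ∈ α' ∧ (φ e).2 ∈ Set.univ} := by
    rw [toOuterMeasure_map_apply]
    congr 1
    ext u
    simp only [hα', Set.mem_preimage, Set.mem_ofPred_eq, Set.mem_univ, and_true]
  have e₃ : P.toOuterMeasure β
      = Q.toOuterMeasure {e | (φ e).1 ∈ Set.univ ∧ (φ e).2 ∈ β'} := by
    rw [toOuterMeasure_map_apply]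
    congr 1
    ext u
    simp only [hβ', Set.mem_preimage, Set.mem_ofPred_eq, Set.mem_univ, true_and]
  -- It is enough that the product of the two total masses is 1; neither need be normalized
  -- separately.
  have h1 : (∑' e, Set.univ.indicator q₁ e) * ∑' e, Set.univ.indicator q₂ e = 1 := by
    rw [← key]
    simp [toOuterMeasure_apply_eq_one_iff]
  rw [e₁, e₂, e₃, key, key, key, ← mul_one (_ * _), ← h1]
  ring

end PMF

/-! ### Structural causal models -/

namespace SCM

variable {U V : Type*} {UVal : U → Type*} {Val : V → Type*}

lemma manipulate_solves_iff (M : SCM UVal Val) (x : Intervention Val) (u : (i : U) → UVal i)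
    (val : (v : V) → Val v) :
    (M.manipulate x).Solves u val ↔ ∀ v, (∀ a, x v = some a → val v = a) ∧
      (x v = none → M.f v (fun i => u i.1) (fun w => val w.1) = val v) := by
  refine forall_congr' fun v => ?_
  simp only [manipulate]
  split
  · rename_i a hx
    constructor
    · rintro rfl
      simp [hx]
    · intro h
      exact (h.1 _ hx).symm
  · rename_i hx
    simp [hx]

/-! ### Solutions and natural values under an intervention -/

variable {M : SCM UVal Val} (hU : M.Uniq)

/-- The solution of the model manipulated by `x`. -/
noncomputable def solution (hU : M.Uniq) (x : Intervention Val) (u : (i : U) → UVal i) (v : V) :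
    Val v :=
  M.potentialOutcome hU u ⟨v, x⟩

/-- The value of the structural function of `v` at the solution of the model manipulated by `x`:
the value that `v` would take under `x` if `v` itself were not intervened on. -/
noncomputable def natural (hU : M.Uniq) (x : Intervention Val) (u : (i : U) → UVal i) (v : V) :
    Val v :=
  M.f v (fun i => u i.1) (fun w => solution hU x u w.1)

lemma solution_solves (x : Intervention Val) (u : (i : U) → UVal i) :
    (M.manipulate x).Solves u (solution hU x u) :=
  (hU u x).choose_spec.1

lemma solution_of_some {x : Intervention Val} (u : (i : U) → UVal i) {v : V} {a : Val v}
    (h : x v = some a) : solution hU x u v = a :=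
  ((M.manipulate_solves_iff x u _).1 (solution_solves hU x u) v).1 a h

lemma solution_of_none {x : Intervention Val} (u : (i : U) → UVal i) {v : V}
    (h : x v = none) : solution hU x u v = natural hU x u v :=
  (((M.manipulate_solves_iff x u _).1 (solution_solves hU x u) v).2 h).symm

lemma eq_solution {x : Intervention Val} {u : (i : U) → UVal i} {val : (v : V) → Val v}
    (h₁ : ∀ v a, x v = some a → val v = a)
    (h₂ : ∀ v, x v = none → M.f v (fun i => u i.1) (fun w => val w.1) = val v) :
    val = solution hU x u :=
  (hU u x).unique ((M.manipulate_solves_iff x u _).2 fun v => ⟨h₁ v, h₂ v⟩)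
    (solution_solves hU x u)

lemma natural_congr {x x' : Intervention Val} {u : (i : U) → UVal i} {v : V}
    (h : ∀ w ∈ M.pa v, solution hU x u w = solution hU x' u w) :
    natural hU x u v = natural hU x' u v := by
  unfold natural
  congr 1
  funext w
  exact h w.1 w.2

/-- The label leaves `v` free and agrees with `x` on its proper ancestors, so by induction along the
DAG both interventions feed the same parent values into the equation of `v`. Acyclicity keeps `v`
out of that induction. -/
lemma potentialOutcome_swigLabel [Finite V] {D : Digraph V} (hD : D.Acyclic)
    (hMD : ∀ v w, D.Adj v w ↔ v ∈ M.pa w) (x : Intervention Val) (u : (i : U) → UVal i) (v : V) :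
    M.potentialOutcome hU u (swigLabel D x v) = natural hU x u v := by
  set y : Intervention Val := x.proj ((D.ancestors v ∩ x.dom) \ {v}) with hy
  have hyv : y v = none := by simp [hy, Intervention.proj]
  have hyw : ∀ w, w ∈ D.ancestors v → w ≠ v → y w = x w := by
    intro w hw hne
    by_cases hx : x w = none
    · simp [hy, Intervention.proj, hx]
    · simp [hy, Intervention.proj, hw, hne, Intervention.dom, hx]
  have key : ∀ w, w ∈ D.ancestors v → w ≠ v → solution hU y u w = solution hU x u w := by
    intro w
    induction w using hD.wellFounded.induction with
    | _ w ih =>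
      intro hw hne
      cases hx : x w with
      | some a =>
        rw [solution_of_some hU u hx, solution_of_some hU u ((hyw w hw hne).trans hx)]
      | none =>
        rw [solution_of_none hU u hx, solution_of_none hU u ((hyw w hw hne).trans hx)]
        refine natural_congr hU fun w' hw' => ?_
        have hadj := (hMD w' w).2 hw'
        refine ih w' hadj (Relation.ReflTransGen.head hadj hw) ?_
        rintro rfl
        exact hD _ (Relation.TransGen.head' hadj hw)
  refine (solution_of_none hU u hyv).trans (natural_congr hU fun w hw => ?_)
  have hadj := (hMD w v).2 hw
  refine key w (.single hadj) ?_
  rintro rfl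
  exact hD _ (.single hadj)

/-- Intervened parents contribute constants and free parents stay in `H`, so unfolding the equations
never meets noise from outside `H`. -/
lemma natural_eq_of_agree [Finite V] {D : Digraph V} (hD : D.Acyclic)
    (hMD : ∀ v w, D.Adj v w ↔ v ∈ M.pa w) (x : Intervention Val) {H : Set V}
    (hH : ∀ v ∈ H, ∀ w, D.Adj w v → x w = none → w ∈ H) {u u' : (i : U) → UVal i}
    (h : ∀ v ∈ H, (fun i : M.exo v => u i.1) = fun i : M.exo v => u' i.1) {v : V} (hv : v ∈ H) :
    natural hU x u v = natural hU x u' v := by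
  induction v using hD.wellFounded.induction with
  | _ v ih =>
    unfold natural
    congr 1
    · exact h v hv
    · funext w
      have hadj := (hMD w.1 v).2 w.2
      cases hx : x w.1 with
      | some a => rw [solution_of_some hU u hx, solution_of_some hU u' hx]
      | none =>
        rw [solution_of_none hU u hx, solution_of_none hU u' hx]
        exact ih w.1 hadj (hH v hv _ hadj hx)

/-! ### Trading conditioning for intervention -/

open Classical in
/-- The intervention that agrees with `x` where that is defined, and sets the remaining variables
of `Z` to `c`. -/
noncomputable def _root_.Intervention.extend (x : Intervention Val) {Z : Set V}
    (c : (v : Z) → Val v.1) : Intervention Val :=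
  fun w => (x w).or (if h : w ∈ Z then some (c ⟨w, h⟩) else none)

lemma _root_.Intervention.extend_eq_none {x : Intervention Val} {Z : Set V}
    {c : (v : Z) → Val v.1} {w : V} : x.extend c w = none ↔ x w = none ∧ w ∉ Z := by
  simp [Intervention.extend]

/-- Consistency: forcing free variables to the values their equations already produce leaves the
solution unchanged. -/
lemma solution_eq_solution_extend (x : Intervention Val) {Z : Set V} (c : (v : Z) → Val v.1)
    (u : (i : U) → UVal i) (h : ∀ v : Z, natural hU x u v = c v) :
    solution hU x u = solution hU (x.extend c) u := by
  refine eq_solution hU (fun v a hv => ?_) (fun v hv => ?_)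
  · cases hx : x v with
    | some b =>
      rw [solution_of_some hU u hx]
      simpa [Intervention.extend, hx] using hv
    | none =>
      rw [solution_of_none hU u hx]
      simp only [Intervention.extend, hx, Option.none_or] at hv
      split at hv
      · rename_i hZ
        exact (h ⟨v, hZ⟩).trans (Option.some.inj hv)
      · simp at hv
  · exact (solution_of_none hU u (Intervention.extend_eq_none.1 hv).1).symm

lemma solution_extend_eq_solution (x : Intervention Val) {Z : Set V} (c : (v : Z) → Val v.1)
    (u : (i : U) → UVal i) (h : ∀ v : Z, natural hU (x.extend c) u v = c v) :
    solution hU (x.extend c) u = solution hU x u := by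
  refine eq_solution hU (fun v a hv => ?_) (fun v hv => ?_)
  · exact solution_of_some hU u (by simp [Intervention.extend, hv])
  · by_cases hZ : v ∈ Z
    · rw [solution_of_some hU u (a := c ⟨v, hZ⟩) (by simp [Intervention.extend, hv, hZ])]
      exact h ⟨v, hZ⟩
    · exact (solution_of_none hU u (Intervention.extend_eq_none.2 ⟨hv, hZ⟩)).symm

/-- Allows the conditioning event to be evaluated under the extended intervention, where influence
no longer passes through `Z`. -/
lemma natural_extend_iff (x : Intervention Val) {Z : Set V} (c : (v : Z) → Val v.1)
    (u : (i : U) → UVal i) :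
    (∀ v : Z, natural hU x u v = c v) ↔ ∀ v : Z, natural hU (x.extend c) u v = c v := by
  constructor
  · intro h v
    rw [← h v]
    exact natural_congr hU fun w _ => by rw [solution_eq_solution_extend hU x c u h]
  · intro h v
    rw [← h v]
    exact natural_congr hU fun w _ => by rw [solution_extend_eq_solution hU x c u h]

lemma natural_extend (x : Intervention Val) {Z : Set V} (c : (v : Z) → Val v.1)
    (u : (i : U) → UVal i) (h : ∀ v : Z, natural hU (x.extend c) u v = c v) (v : V) :
    natural hU (x.extend c) u v = natural hU x u v :=
  natural_congr hU fun w _ => by rw [solution_extend_eq_solution hU x c u h]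

/-! ### Markov property by splitting the noise -/

/-- The event that each variable of `S` has the given natural value under `x`. -/
def naturalEvent (hU : M.Uniq) (x : Intervention Val) {S : Set V} (s : (v : S) → Val v.1) :
    Set ((i : U) → UVal i) :=
  {u | ∀ v : S, natural hU x u v = s v}

/-- The global Markov property of the single-world intervention graph. -/
theorem naturalEvent_markov [Fintype V] {D : Digraph V} (hD : D.Acyclic) (hMD : M.HasDiagram D)
    (x : Intervention Val) {X Y Z : Set V}
    (hsep : (swig D x).DSep (Sum.inl '' X) (Sum.inl '' Y) (Sum.inl '' Z))
    (a : (v : X) → Val v.1) (b : (v : Y) → Val v.1) (c : (v : Z) → Val v.1) :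
    M.P.toOuterMeasure (naturalEvent hU x a ∩ naturalEvent hU x b ∩ naturalEvent hU x c)
        * M.P.toOuterMeasure (naturalEvent hU x c)
      = M.P.toOuterMeasure (naturalEvent hU x a ∩ naturalEvent hU x c)
        * M.P.toOuterMeasure (naturalEvent hU x b ∩ naturalEvent hU x c) := by
  let G := swig D x
  let R : Bool → V → Prop := fun s v => G.Reaches (Sum.inl '' Z) (Sum.inl '' Y) s (Sum.inl v)
  have hmem : ∀ {v : V} {S : Set V}, (Sum.inl v : V ⊕ x.dom) ∈ Sum.inl '' S ↔ v ∈ S := by simp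
  have hR : ∀ {v : V}, R true v → v ∉ Z → R false v := fun h hv => h.to_false (hmem.not.2 hv)
  have hadj : ∀ {v w : V}, x v = none → D.Adj v w → G.Adj (Sum.inl v) (Sum.inl w) :=
    fun hv h => ⟨fun h' => h' hv, h⟩
  let x' := x.extend c
  -- the variables whose values depend on the `Y`-side noise, and those on the `X`-side
  let H₂ : Set V := {v | R true v}
  let H₁ : Set V := {v | (v ∉ Z → ¬ R false v) ∧ (v ∈ Z → ¬ R true v)}
  have hdisj : ∀ v ∈ H₁, v ∉ H₂ := by
    intro v hv hv'
    by_cases hZ : v ∈ Z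
    · exact hv.2 hZ hv'
    · exact hv.1 hZ (hR hv' hZ)
  have hH₂ : ∀ v ∈ H₂, ∀ w, D.Adj w v → x' w = none → w ∈ H₂ := by
    intro v hv w hwv hw
    obtain ⟨hx, hZ⟩ := Intervention.extend_eq_none.1 hw
    exact .down _ (hmem.not.2 hZ) (hadj hx hwv) hv
  -- By contraposition: an active trail from `w` to `Y` extends along the arrow `w → v` to one from
  -- `v`, where `v` is a collider if it lies in `Z` and a non-collider otherwise.
  have hH₁ : ∀ v ∈ H₁, ∀ w, D.Adj w v → x' w = none → w ∈ H₁ := by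
    intro v hv w hwv hw
    obtain ⟨hx, hZ⟩ := Intervention.extend_eq_none.1 hw
    refine ⟨fun _ hw' => ?_, fun h => absurd h hZ⟩
    by_cases hvZ : v ∈ Z
    · exact hv.2 hvZ (.collide (hmem.2 hvZ) (hadj hx hwv) hw')
    · exact hv.1 hvZ (.up (hmem.not.2 hvZ) (hadj hx hwv) hw')
  have hX : ∀ v ∈ X, v ∉ Z → v ∈ H₁ := fun v hv hZ =>
    ⟨fun _ => hsep.not_reaches (swig_asymm hD x) (hmem.2 hv), fun h => absurd h hZ⟩
  have hY : ∀ v ∈ Y, v ∉ Z → v ∈ H₂ := fun v hv hZ => .target _ (hmem.not.2 hZ) (hmem.2 hv)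
  have hZ₁ : ∀ v ∈ Z, v ∉ H₂ → v ∈ H₁ := fun v hv h => ⟨fun h' => absurd hv h', fun _ => h⟩
  have eq₁ : ∀ {u u' : (i : U) → UVal i},
      (∀ v ∉ H₂, (fun i : M.exo v => u i.1) = fun i : M.exo v => u' i.1) → ∀ v ∈ H₁,
      natural hU x' u v = natural hU x' u' v := fun h v hv =>
    natural_eq_of_agree hU hD hMD.1 x' hH₁ (fun v hv => h v (hdisj v hv)) hv
  have eq₂ : ∀ {u u' : (i : U) → UVal i},
      (∀ v ∈ H₂, (fun i : M.exo v => u i.1) = fun i : M.exo v => u' i.1) → ∀ v ∈ H₂,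
      natural hU x' u v = natural hU x' u' v := fun h v hv =>
    natural_eq_of_agree hU hD hMD.1 x' hH₂ h hv
  -- `X` and `Y` may meet `Z`. There the prescribed values must match `c`, a condition free of
  -- noise; only variables outside `Z` must be placed in one of the two groups.
  let A : Set ((i : U) → UVal i) := {u | ∀ v : X, (∀ h : v.1 ∈ Z, a v = c ⟨v.1, h⟩) ∧
    (v.1 ∉ Z → natural hU x' u v = a v)}
  let B : Set ((i : U) → UVal i) := {u | ∀ v : Y, (∀ h : v.1 ∈ Z, b v = c ⟨v.1, h⟩) ∧
    (v.1 ∉ Z → natural hU x' u v = b v)}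
  let C₁ : Set ((i : U) → UVal i) := {u | ∀ v : Z, v.1 ∉ H₂ → natural hU x' u v = c v}
  let C₂ : Set ((i : U) → UVal i) := {u | ∀ v : Z, v.1 ∈ H₂ → natural hU x' u v = c v}
  have hA : ∀ u u', (∀ v ∉ H₂, (fun i : M.exo v => u i.1) = fun i : M.exo v => u' i.1) →
      u ∈ A → u' ∈ A := fun u u' h hu v =>
    ⟨(hu v).1, fun hv => (eq₁ h _ (hX _ v.2 hv)).symm.trans ((hu v).2 hv)⟩
  have hC₁ : ∀ u u', (∀ v ∉ H₂, (fun i : M.exo v => u i.1) = fun i : M.exo v => u' i.1) →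
      u ∈ C₁ → u' ∈ C₁ := fun u u' h hu v hv =>
    (eq₁ h _ (hZ₁ _ v.2 hv)).symm.trans (hu v hv)
  have hB : ∀ u u', (∀ v ∈ H₂, (fun i : M.exo v => u i.1) = fun i : M.exo v => u' i.1) →
      u ∈ B → u' ∈ B := fun u u' h hu v =>
    ⟨(hu v).1, fun hv => (eq₂ h _ (hY _ v.2 hv)).symm.trans ((hu v).2 hv)⟩
  have hC₂ : ∀ u u', (∀ v ∈ H₂, (fun i : M.exo v => u i.1) = fun i : M.exo v => u' i.1) →
      u ∈ C₂ → u' ∈ C₂ := fun u u' h hu v hv =>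
    (eq₂ h _ hv).symm.trans (hu v hv)
  have hind : ∀ α β : Set ((i : U) → UVal i),
      (∀ u u', (∀ v ∈ H₂, (fun i : M.exo v => u i.1) = fun i : M.exo v => u' i.1) → u ∈ α → u' ∈ α) →
      (∀ u u', (∀ v ∉ H₂, (fun i : M.exo v => u i.1) = fun i : M.exo v => u' i.1) → u ∈ β → u' ∈ β) →
      M.P.toOuterMeasure (α ∩ β) = M.P.toOuterMeasure α * M.P.toOuterMeasure β :=
    M.P.toOuterMeasure_inter_of_determined (fun v u (i : M.exo v) => u i.1) hMD.2.2 H₂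
  have inter : ∀ {p : ((i : U) → UVal i) → ((i : U) → UVal i) → Prop}
      {α β : Set ((i : U) → UVal i)},
      (∀ u u', p u u' → u ∈ α → u' ∈ α) → (∀ u u', p u u' → u ∈ β → u' ∈ β) →
      ∀ u u', p u u' → u ∈ α ∩ β → u' ∈ α ∩ β :=
    fun h₁ h₂ u u' h hu => ⟨h₁ u u' h hu.1, h₂ u u' h hu.2⟩
  have eC : naturalEvent hU x c = C₂ ∩ C₁ := by
    ext u
    refine (natural_extend_iff hU x c u).trans ⟨fun h => ⟨fun v _ => h v, fun v _ => h v⟩, ?_⟩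
    intro h v
    by_cases hv : v.1 ∈ H₂
    · exact h.1 v hv
    · exact h.2 v hv
  have side : ∀ {S : Set V} (s : (v : S) → Val v.1) (u : (i : U) → UVal i),
      u ∈ naturalEvent hU x c → (u ∈ naturalEvent hU x s ↔
        ∀ v : S, (∀ h : v.1 ∈ Z, s v = c ⟨v.1, h⟩) ∧ (v.1 ∉ Z → natural hU x' u v = s v)) := by
    intro S s u hu
    have hnat := natural_extend hU x c u ((natural_extend_iff hU x c u).1 hu)
    refine forall_congr' fun v => ?_
    rw [show natural hU x' u v = natural hU x u v from hnat v]
    constructor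
    · exact fun h => ⟨fun hZ => h.symm.trans (hu ⟨v.1, hZ⟩), fun _ => h⟩
    · intro h
      by_cases hZ : v.1 ∈ Z
      · exact (hu ⟨v.1, hZ⟩).trans (h.1 hZ).symm
      · exact h.2 hZ
  have eA : naturalEvent hU x a ∩ naturalEvent hU x c = C₂ ∩ (A ∩ C₁) := by
    rw [← Set.inter_left_comm, ← eC]
    ext u
    exact and_congr_left fun h => side a u h
  have eB : naturalEvent hU x b ∩ naturalEvent hU x c = (B ∩ C₂) ∩ C₁ := by
    rw [Set.inter_assoc, ← eC]
    ext u
    exact and_congr_left fun h => side b u h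
  have eAB : naturalEvent hU x a ∩ naturalEvent hU x b ∩ naturalEvent hU x c
      = (B ∩ C₂) ∩ (A ∩ C₁) := by
    rw [Set.inter_inter_inter_comm, ← eC, Set.inter_comm B A]
    ext u
    exact and_congr_left fun h => and_congr (side a u h) (side b u h)
  rw [eAB, eA, eB, eC, hind _ _ (inter hB hC₂) (inter hA hC₁), hind _ _ hC₂ hC₁,
    hind _ _ hC₂ (inter hA hC₁), hind _ _ (inter hB hC₂) hC₁]
  ring

/-- Both interventions supply the equation of `Y` with the same parent values and leave `Y` free, so
no acyclicity is required. -/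
lemma potentialOutcome_proj_parents {D : Digraph V} (hMD : ∀ v w, D.Adj v w ↔ v ∈ M.pa w)
    {Y : V} {a : Intervention Val} (ha : D.parents Y ⊆ a.dom) (hY : Y ∉ a.dom)
    (u : (i : U) → UVal i) :
    M.potentialOutcome hU u ⟨Y, a.proj (D.parents Y)⟩ = M.potentialOutcome hU u ⟨Y, a⟩ := by
  have hY' : a Y = none := not_not.1 hY
  have hp : a.proj (D.parents Y) Y = none := by simp [Intervention.proj, hY']
  refine (solution_of_none hU u hp).trans
    (.trans (natural_congr hU fun w hw => ?_) (solution_of_none hU u hY').symm)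
  have hw' : w ∈ D.parents Y := (hMD w Y).2 hw
  obtain ⟨y, hy⟩ := Option.ne_none_iff_exists'.1 (ha hw')
  rw [solution_of_some hU u hy,
    solution_of_some hU u (a := y) (by simp [Intervention.proj, hw', hy])]

end SCM

/-! ### Full models -/

namespace RCM

variable {𝒰 V : Type*} {Val : V → Type*}

open Classical in
/-- A full effective model defines all potential outcomes. -/
lemma Full.outcomes_eq_univ {R : RCM 𝒰 Val} (hR : R.Full) (hE : R.Effective)
    (hne : ∀ v, Nonempty (Val v)) : R.outcomes = Set.univ := by
  let R' : RCM 𝒰 Val :=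
    { outcomes := Set.univ
      -- A new outcome takes its intervened value where effectiveness demands one, and otherwise an
      -- arbitrary constant.
      response := fun o i => if h : o.1 ∈ R.outcomes then R.response ⟨o.1, h⟩ i
        else (o.1.intv o.1.var).getD (hne _).some
      P := R.P }
  refine (hR R' ?_ ⟨rfl, Set.subset_univ _, ?_⟩).symm
  · intro o y hy i
    by_cases h : o.1 ∈ R.outcomes
    · simpa [R', h] using hE ⟨o.1, h⟩ y hy i
    · simp [R', h, hy]
  · intro o
    funext i
    simp [R', o.2]

end RCM

theorem mainTheorem10 {U V 𝒰 : Type*} [Finite U] [Fintype V] [Finite 𝒰]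
    {UVal : U → Type*} {Val : V → Type*}
    (D : Digraph V) (hD : D.Acyclic)
    (M : SCM UVal Val) (hM : M.HasDiagram D)
    (R : RCM 𝒰 Val) (hR : R.Full) (hMR : M.Represents R) :
    R.IsFFRCISTG D := by
  obtain ⟨hE, hU, hP⟩ := hMR
  -- The ranges are not assumed nonempty: a solution of `M` at some noise value supplies their
  -- elements.
  obtain ⟨u₀, -⟩ := M.P.support_nonempty
  have huniv := hR.outcomes_eq_univ hE fun v =>
    ⟨SCM.solution hU (fun _ => none) u₀ v⟩
  have hprob : ∀ E : Set (Counterfactual R.outcomes), R.prob E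
      = M.P.toOuterMeasure ((fun u (o : R.outcomes) => M.potentialOutcome hU u o.1) ⁻¹' E) := by
    intro E
    rw [RCM.prob, ← hP, SCM.Pcf, PMF.map_comp, PMF.toOuterMeasure_map_apply]
    rfl
  have hholds : ∀ u (o : PotentialOutcome Val) (y : Val o.var),
      Counterfactual.Holds (O := R.outcomes) (fun o => M.potentialOutcome hU u o.1) o y
        ↔ M.potentialOutcome hU u o = y := fun u o y =>
    ⟨fun ⟨_, h⟩ => h, fun h => ⟨huniv ▸ Set.mem_univ o, h⟩⟩
  refine ⟨hE, hR, fun Y a ha hY y => ?_, fun x X Y Z hsep a b c => ?_⟩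
  · rw [hprob]
    -- The violating event is empty as a set of noise values, not merely null.
    convert MeasureTheory.measure_empty (μ := M.P.toOuterMeasure)
    ext u
    simp only [Set.mem_preimage, Set.mem_ofPred_eq, Set.mem_empty_iff_false, iff_false, not_not]
    rw [hholds, hholds, SCM.potentialOutcome_proj_parents hU hM.1 ha hY]
  · have hev : ∀ {S : Set V} (s : (v : S) → Val v.1),
        (fun u (o : R.outcomes) => M.potentialOutcome hU u o.1) ⁻¹' swigEvent R.outcomes D x s
          = SCM.naturalEvent hU x s := by
      intro S s
      ext u
      refine forall_congr' fun v => ?_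
      refine (hholds u (swigLabel D x v.1) (s v)).trans ?_
      rw [SCM.potentialOutcome_swigLabel hU hD hM.1]
      rfl
    simp only [hprob, Set.preimage_inter, hev]
    exact SCM.naturalEvent_markov hU hD hM x hsep a b c
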